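/- **Gelfand–Naĭmark Theorem.** Let $A$ be a (complex, not necessarily unital) C\*-algebra. A *state* on $A$ is a linear functional $\psi : A \to \mathbb{C}$ such that $\psi(a^*a) \ge 0$ for all $a \in A$ ($\psi$ is positive), such that for each $b \in A$ the functional $a \mapsto \psi(b^*ab)$ is continuous on the set of Hermitian elements of $A$, and such that $\psi$ has finite variation $$v(\psi) := \inf\{v \ge 0 : |\psi(a)|^2 \le v\,\psi(a^*a) \text{ for all } a \in A\} = 1 .$$ Let $S(A)$ be the set of states on $A$. For $\psi \in S(A)$ let $\pi_\psi$ be the GNS representation of $A$ in the Hilbert space $H_\psi$ associated with $\psi$: $H_\psi$ is the Hilbert space completion of $A$ for the form $\langle a, b\rangle_\psi = \psi(b^*a)$ (modulo its null space), and $\pi_\psi(a)$ extends left multiplication by $a$. Let $\pi_u := \bigoplus_{\psi \in S(A)} \pi_\psi$ be the universal representation of $A$ in the Hilbert space $H_u := \bigoplus_{\psi \in S(A)} H_\psi$. Put $\|a\|_o := \sup_{\psi \in S(A)} \psi(a^*a)^{1/2}$ for $a \in A$ (with $\|a\|_o := 0$ if $S(A) = \emptyset$). Let the enveloping C\*-algebra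 $C^*(A)$ be the completion of the quotient of $A$ by the two-sided \*-ideal $\{a \in A : \|a\|_o = 0\}$ in the norm induced by $\|\cdot\|_o$, and let $j : A \to C^*(A)$ be the canonical \*-homomorphism. Then: 1. $\|\pi_u(a)\| = \|a\|_o = \|a\|$ for all $a \in A$. 2. The range $\pi_u(A)$ is a closed \*-subalgebra of $B(H_u)$, and $\pi_u$ is an isometric \*-isomorphism of $A$ onto $\pi_u(A)$. In particular, $A$ is isomorphic as a C\*-algebra to a C\*-algebra of bounded linear operators on a Hilbert space. 3. The map $j$ is an isometric \*-isomorphism of $A$ onto $C^*(A)$, so that $C^*(A)$ can be identified with $A$. -/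

import Mathlib

noncomputable section

namespace GelfandNaimark

open scoped ComplexOrder InnerProductSpace Topology
open UniformSpace Filter

/-! ### States and the seminorm they define -/

section States

variable {A : Type*} [NonUnitalNormedRing A] [NormedSpace ℂ A] [StarRing A]

/-- A linear functional `φ` is positive if `φ(a* a) ≥ 0` for all `a`. -/
def IsPositive (φ : A →ₗ[ℂ] ℂ) : Prop :=
  ∀ a : A, 0 ≤ φ (star a * a)

/-- `φ` is weakly continuous on the Hermitian part of `A`: for each `b`, the functional
`a ↦ φ(b* a b)` is continuous on the set of Hermitian elements. -/
def IsWeaklyContinuousOnSelfAdjoint (φ : A →ₗ[ℂ] ℂ) : Prop :=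
  ∀ b : A, ContinuousOn (fun a : A => φ (star b * a * b)) {a : A | IsSelfAdjoint a}

/-- The set of all `v ≥ 0` with `|φ(a)|² ≤ v φ(a* a)` for all `a`. -/
def variationBounds (φ : A →ₗ[ℂ] ℂ) : Set ℝ :=
  {v : ℝ | 0 ≤ v ∧ ∀ a : A, ‖φ a‖ ^ 2 ≤ v * (φ (star a * a)).re}

/-- `φ` has finite variation. -/
def HasFiniteVariation (φ : A →ₗ[ℂ] ℂ) : Prop :=
  (variationBounds φ).Nonempty

/-- The variation of `φ` (meaningful if `φ` has finite variation). -/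
def variation (φ : A →ₗ[ℂ] ℂ) : ℝ :=
  sInf (variationBounds φ)

/-- A state is a positive linear functional that is weakly continuous on the Hermitian part
and has finite variation equal to `1`. -/
structure IsState (ψ : A →ₗ[ℂ] ℂ) : Prop where
  isPositive : IsPositive ψ
  weaklyContinuous : IsWeaklyContinuousOnSelfAdjoint ψ
  hasFiniteVariation : HasFiniteVariation ψ
  variation_eq_one : variation ψ = 1

variable (A) in
/-- The set `S(A)` of states, as a type. -/
def State : Type _ := {ψ : A →ₗ[ℂ] ℂ // IsState ψ}

/-- `‖a‖_o`, the supremum of `ψ(a* a)^{1/2}` over all states `ψ` (and `0` if there are none). -/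
def gnSeminorm (a : A) : ℝ :=
  ⨆ ψ : State A, √(ψ.1 (star a * a)).re

theorem IsState.norm_sq_le {ψ : A →ₗ[ℂ] ℂ} (h : IsState ψ) (a : A) :
    ‖ψ a‖ ^ 2 ≤ (ψ (star a * a)).re := by
  have hcl : IsClosed (variationBounds ψ) := by
    have : variationBounds ψ = Set.Ici 0 ∩
        ⋂ a : A, {v : ℝ | ‖ψ a‖ ^ 2 ≤ v * (ψ (star a * a)).re} := by
      ext v; simp [variationBounds]
    rw [this]
    exact isClosed_Ici.inter (isClosed_iInter fun a =>
      isClosed_le continuous_const (by fun_prop))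
  have := hcl.csInf_mem h.hasFiniteVariation ⟨0, fun v hv => hv.1⟩
  have h1 : sInf (variationBounds ψ) = 1 := h.variation_eq_one
  rw [h1] at this
  simpa using this.2 a

end States

/-! ### The universal representation -/

section CStar

variable {A : Type*} [NonUnitalCStarAlgebra A]

/-- A C*-algebra carries its canonical order, in which the nonnegative elements are
those of the form `a* a`. -/
local instance (priority := 50) : PartialOrder A := CStarAlgebra.spectralOrder A

local instance (priority := 50) : StarOrderedRing A := CStarAlgebra.spectralOrderedRing A

/-- A state, bundled as a positive linear map into `ℂ`. -/
def State.toPositive (ψ : State A) : A →ₚ[ℂ] ℂ :=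
  PositiveLinearMap.mk₀ ψ.1 fun x hx => by
    obtain ⟨b, rfl⟩ := CStarAlgebra.nonneg_iff_eq_star_mul_self.mp hx
    exact ψ.2.isPositive b

theorem State.toPositive_apply (ψ : State A) (a : A) : ψ.toPositive a = ψ.1 a := rfl

/-- The Hilbert space `H_ψ`, the completion of `A` for the form `⟨a, b⟩ = ψ(a* b)`. -/
abbrev State.GNSSpace (ψ : State A) : Type _ := ψ.toPositive.GNS

/-- The GNS representation `π_ψ`, given on the dense image of `A` by left multiplication. -/
def State.gnsRep (ψ : State A) : A →⋆ₙₐ[ℂ] (ψ.GNSSpace →L[ℂ] ψ.GNSSpace) :=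
  ψ.toPositive.gnsNonUnitalStarAlgHom

variable (A) in
/-- The universal Hilbert space: the Hilbert direct sum of the `H_ψ` over all states `ψ`. -/
abbrev UniversalSpace : Type _ := lp (fun ψ : State A => ψ.GNSSpace) 2

theorem State.norm_gnsRep_le (ψ : State A) (a : A) : ‖ψ.gnsRep a‖ ≤ ‖a‖ :=
  NonUnitalStarAlgHom.norm_apply_le ψ.gnsRep a

variable (A) in
/-- The universal representation: the direct sum of the GNS representations of all states,
acting by `(π_u(a) x)_ψ = π_ψ(a) x_ψ`. -/
def universalRep : A →⋆ₙₐ[ℂ] (UniversalSpace A →L[ℂ] UniversalSpace A) where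
  toFun a := lp.mapCLM 2 (fun ψ : State A => ψ.gnsRep a) (norm_nonneg a)
    fun ψ => ψ.norm_gnsRep_le a
  map_smul' c a := by ext x ψ; simp
  map_zero' := by ext x ψ; simp
  map_add' a b := by ext x ψ; simp
  map_mul' a b := by ext x ψ; simp
  map_star' a := by
    refine (ContinuousLinearMap.eq_adjoint_iff _ _).mpr fun x y => ?_
    simp only [lp.inner_eq_tsum]
    refine tsum_congr fun ψ => ?_
    simp [map_star, ContinuousLinearMap.star_eq_adjoint, ContinuousLinearMap.adjoint_inner_left]

theorem universalRep_apply (a : A) (x : UniversalSpace A) (ψ : State A) :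
    (universalRep A a x) ψ = ψ.gnsRep a (x ψ) := rfl

/-! ### The seminorm is an algebra seminorm with the C*-property -/

theorem State.gns_norm (ψ : State A) (a : A) :
    ‖ψ.toPositive.toPreGNS a‖ = √(ψ.1 (star a * a)).re := rfl

theorem State.re_nonneg (ψ : State A) (a : A) : 0 ≤ (ψ.1 (star a * a)).re :=
  (Complex.nonneg_iff.mp (ψ.2.isPositive a)).1

theorem State.continuous (ψ : State A) : Continuous ψ.1 :=
  map_continuous ψ.toPositive

theorem State.sqrt_le_norm (ψ : State A) (a : A) : √(ψ.1 (star a * a)).re ≤ ‖a‖ := by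
  let f : A →L[ℂ] ℂ := ⟨ψ.1, ψ.continuous⟩
  have hf : ∀ a, ‖f a‖ ^ 2 ≤ ‖f‖ * ‖a‖ ^ 2 := fun a => by
    calc ‖f a‖ ^ 2 ≤ (f (star a * a)).re := ψ.2.norm_sq_le a
      _ ≤ ‖f (star a * a)‖ := Complex.re_le_norm _
      _ ≤ ‖f‖ * ‖star a * a‖ := f.le_opNorm _
      _ = ‖f‖ * ‖a‖ ^ 2 := by rw [CStarRing.norm_star_mul_self, sq]
  have h1 : ‖f‖ ≤ √‖f‖ := f.opNorm_le_bound (Real.sqrt_nonneg _) fun a => by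
    have := Real.sqrt_le_sqrt (hf a)
    rwa [Real.sqrt_sq (norm_nonneg _), Real.sqrt_mul (norm_nonneg _),
      Real.sqrt_sq (norm_nonneg _)] at this
  have h2 : ‖f‖ ≤ 1 := by
    have h3 := Real.sq_sqrt (norm_nonneg f)
    have h4 := Real.sqrt_nonneg ‖f‖
    nlinarith
  refine Real.sqrt_le_iff.mpr ⟨norm_nonneg _, ?_⟩
  calc (f (star a * a)).re ≤ ‖f (star a * a)‖ := Complex.re_le_norm _
      _ ≤ ‖f‖ * ‖star a * a‖ := f.le_opNorm _
      _ = ‖f‖ * ‖a‖ ^ 2 := by rw [CStarRing.norm_star_mul_self, sq]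
      _ ≤ ‖a‖ ^ 2 := by nlinarith [sq_nonneg ‖a‖]

/-- The supremum that defines `‖a‖_o` is over a bounded set. -/
theorem bddAbove_gnSeminorm (a : A) :
    BddAbove (Set.range fun ψ : State A => √(ψ.1 (star a * a)).re) :=
  ⟨‖a‖, by rintro _ ⟨ψ, rfl⟩; exact ψ.sqrt_le_norm a⟩

theorem State.sqrt_le_gnSeminorm (ψ : State A) (a : A) :
    √(ψ.1 (star a * a)).re ≤ gnSeminorm a :=
  le_ciSup (bddAbove_gnSeminorm a) ψ

theorem gnSeminorm_nonneg (a : A) : 0 ≤ gnSeminorm a :=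
  Real.iSup_nonneg fun _ => Real.sqrt_nonneg _

theorem gnSeminorm_zero : gnSeminorm (0 : A) = 0 := by
  simp [gnSeminorm]

theorem gnSeminorm_neg (a : A) : gnSeminorm (-a) = gnSeminorm a := by
  simp [gnSeminorm]

theorem gnSeminorm_add_le (a b : A) : gnSeminorm (a + b) ≤ gnSeminorm a + gnSeminorm b := by
  refine Real.iSup_le (fun ψ => ?_) (add_nonneg (gnSeminorm_nonneg a) (gnSeminorm_nonneg b))
  rw [← ψ.gns_norm, map_add]
  exact (norm_add_le _ _).trans
    (add_le_add (ψ.sqrt_le_gnSeminorm a) (ψ.sqrt_le_gnSeminorm b))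

theorem gnSeminorm_smul_le (c : ℂ) (a : A) : gnSeminorm (c • a) ≤ ‖c‖ * gnSeminorm a := by
  refine Real.iSup_le (fun ψ => ?_) (mul_nonneg (norm_nonneg c) (gnSeminorm_nonneg a))
  rw [← ψ.gns_norm, map_smul, norm_smul]
  exact mul_le_mul_of_nonneg_left (ψ.sqrt_le_gnSeminorm a) (norm_nonneg c)

/-- The normalised vector functional `a ↦ ψ(b* a b) / ψ(b* b)` is a state. -/
theorem State.isState_conj (ψ : State A) (b : A) (hb : 0 < (ψ.1 (star b * b)).re) :
    IsState (((ψ.1 (star b * b)).re⁻¹ : ℂ) •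
      (ψ.1 ∘ₗ LinearMap.mulRight ℂ b ∘ₗ LinearMap.mulLeft ℂ (star b))) := by
  set r : ℝ := (ψ.1 (star b * b)).re with hr
  set φ : A →ₗ[ℂ] ℂ := ((r⁻¹ : ℂ) •
      (ψ.1 ∘ₗ LinearMap.mulRight ℂ b ∘ₗ LinearMap.mulLeft ℂ (star b))) with hφ
  have hrφ (a : A) : φ a = (r⁻¹ : ℂ) * ψ.1 (star b * a * b) := by
    simp [hφ]
  have hψc := ψ.continuous
  have hφc : Continuous φ := by
    have : (φ : A → ℂ) = fun a => (r⁻¹ : ℂ) * ψ.1 (star b * a * b) := funext hrφ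
    rw [this]
    fun_prop
  have hre (a : A) : (φ (star a * a)).re = r⁻¹ * (ψ.1 (star (a * b) * (a * b))).re := by
    rw [hrφ, ← Complex.ofReal_inv, Complex.re_ofReal_mul, star_mul]
    simp only [mul_assoc]
  have hone : (1 : ℝ) ∈ variationBounds φ := by
    refine ⟨zero_le_one, fun a => ?_⟩
    have hcs : ‖ψ.1 (star b * (a * b))‖ ^ 2 ≤ r * (ψ.1 (star (a * b) * (a * b))).re := by
      have h := norm_inner_le_norm (𝕜 := ℂ) (ψ.toPositive.toPreGNS b)
        (ψ.toPositive.toPreGNS (a * b))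
      rw [ψ.gns_norm, ψ.gns_norm] at h
      have h' := pow_le_pow_left₀ (norm_nonneg _) h 2
      rw [mul_pow, Real.sq_sqrt (ψ.re_nonneg _), Real.sq_sqrt (ψ.re_nonneg _)] at h'
      exact h'
    rw [hre, hrφ, norm_mul, mul_pow, mul_assoc (star b), ← Complex.ofReal_inv, Complex.norm_real,
      Real.norm_of_nonneg (inv_nonneg.mpr hb.le), one_mul]
    calc r⁻¹ ^ 2 * ‖ψ.1 (star b * (a * b))‖ ^ 2
        ≤ r⁻¹ ^ 2 * (r * (ψ.1 (star (a * b) * (a * b))).re) := by gcongr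
      _ = r⁻¹ * (ψ.1 (star (a * b) * (a * b))).re := by
        field_simp
  refine ⟨fun a => ?_, fun c => ?_, ⟨1, hone⟩, ?_⟩
  · rw [hrφ, ← Complex.ofReal_inv]
    refine mul_nonneg (Complex.zero_le_real.mpr (inv_nonneg.mpr hb.le)) ?_
    have := ψ.2.isPositive (a * b)
    rwa [star_mul, mul_assoc, ← mul_assoc (star a), ← mul_assoc] at this
  · exact Continuous.continuousOn (by fun_prop)
  · refine le_antisymm (csInf_le ⟨0, fun v hv => hv.1⟩ hone) (le_csInf ⟨1, hone⟩ fun v hv => ?_)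
    have hl := (CStarAlgebra.increasingApproximateUnit A)
    have hlim : Tendsto (fun e : A => e * b) (CStarAlgebra.approximateUnit A) (𝓝 b) :=
      hl.tendsto_mul_right b
    have hself : ψ.1 (star b * b) = (r : ℂ) := by
      apply Complex.ext
      · simp [hr]
      · simpa using (Complex.nonneg_iff.mp (ψ.2.isPositive b)).2.symm
    have h1 : Tendsto (fun e : A => ‖φ e‖ ^ 2) (CStarAlgebra.approximateUnit A) (𝓝 1) := by
      have : Tendsto (fun e : A => ‖(r⁻¹ : ℂ) * ψ.1 (star b * (e * b))‖ ^ 2)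
          (CStarAlgebra.approximateUnit A) (𝓝 (‖(r⁻¹ : ℂ) * ψ.1 (star b * b)‖ ^ 2)) :=
        ((by fun_prop : Continuous fun x : A =>
          ‖(r⁻¹ : ℂ) * ψ.1 (star b * x)‖ ^ 2).tendsto b).comp hlim
      rw [hself, inv_mul_cancel₀ (by exact_mod_cast hb.ne')] at this
      simpa [hrφ, mul_assoc] using this
    have h2 : Tendsto (fun e : A => v * (φ (star e * e)).re)
        (CStarAlgebra.approximateUnit A) (𝓝 v) := by
      have : Tendsto (fun e : A => v * (r⁻¹ * (ψ.1 (star (e * b) * (e * b))).re))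
          (CStarAlgebra.approximateUnit A) (𝓝 (v * (r⁻¹ * (ψ.1 (star b * b)).re))) :=
        ((by fun_prop : Continuous fun x : A =>
          v * (r⁻¹ * (ψ.1 (star x * x)).re)).tendsto b).comp hlim
      rw [← hr, inv_mul_cancel₀ hb.ne', mul_one] at this
      simpa only [hre] using this
    exact le_of_tendsto_of_tendsto' h1 h2 hv.2

theorem State.sqrt_mul_le (ψ : State A) (a b : A) :
    √(ψ.1 (star (a * b) * (a * b))).re ≤ gnSeminorm a * √(ψ.1 (star b * b)).re := by
  rcases (ψ.re_nonneg b).eq_or_lt with hb | hb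
  · have h := (ψ.toPositive.leftMulMapPreGNS a).le_opNorm (ψ.toPositive.toPreGNS b)
    rw [ψ.gns_norm b, ← hb, Real.sqrt_zero, mul_zero] at h
    rw [← hb, Real.sqrt_zero, mul_zero]
    exact h
  · have h := State.sqrt_le_gnSeminorm ⟨_, ψ.isState_conj b hb⟩ a
    have e : √(ψ.1 (star (a * b) * (a * b))).re
        = √((((ψ.1 (star b * b)).re⁻¹ : ℂ) •
      (ψ.1 ∘ₗ LinearMap.mulRight ℂ b ∘ₗ LinearMap.mulLeft ℂ (star b))) (star a * a)).re
          * √(ψ.1 (star b * b)).re := by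
      rw [← Real.sqrt_mul' _ hb.le]
      congr 1
      simp only [LinearMap.smul_apply, LinearMap.comp_apply, LinearMap.mulRight_apply,
        LinearMap.mulLeft_apply, smul_eq_mul, star_mul]
      rw [← Complex.ofReal_inv, Complex.re_ofReal_mul]
      simp only [mul_assoc]
      field_simp
    rw [e]
    exact mul_le_mul_of_nonneg_right h (Real.sqrt_nonneg _)

theorem gnSeminorm_mul_le (a b : A) : gnSeminorm (a * b) ≤ gnSeminorm a * gnSeminorm b :=
  Real.iSup_le (fun ψ => (ψ.sqrt_mul_le a b).trans
    (mul_le_mul_of_nonneg_left (ψ.sqrt_le_gnSeminorm b) (gnSeminorm_nonneg a)))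
    (mul_nonneg (gnSeminorm_nonneg a) (gnSeminorm_nonneg b))

theorem gnSeminorm_mul_self_le (a : A) :
    gnSeminorm a * gnSeminorm a ≤ gnSeminorm (star a * a) := by
  have h : gnSeminorm a ≤ √(gnSeminorm (star a * a)) :=
    Real.iSup_le (fun ψ => Real.sqrt_le_sqrt
      ((Complex.re_le_norm _).trans ((Real.le_sqrt (norm_nonneg _) (ψ.re_nonneg _)).mpr
        (ψ.2.norm_sq_le _) |>.trans (ψ.sqrt_le_gnSeminorm _)))) (Real.sqrt_nonneg _)
  calc _ ≤ √(gnSeminorm (star a * a)) * √(gnSeminorm (star a * a)) :=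
        mul_self_le_mul_self (gnSeminorm_nonneg a) h
    _ = _ := Real.mul_self_sqrt (gnSeminorm_nonneg _)

theorem gnSeminorm_star (a : A) : gnSeminorm (star a) = gnSeminorm a := by
  have key (a : A) : gnSeminorm a ≤ gnSeminorm (star a) := by
    rcases (gnSeminorm_nonneg a).eq_or_lt with h | h
    · rw [← h]; exact gnSeminorm_nonneg _
    · exact le_of_mul_le_mul_right ((gnSeminorm_mul_self_le a).trans (gnSeminorm_mul_le _ _)) h
  exact le_antisymm (by simpa using key (star a)) (key a)

end CStar

/-! ### Completing a pre-C*-algebra -/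

section Completion

variable (B : Type*) [NonUnitalNormedRing B] [StarRing B] [CStarRing B] [NormedSpace ℂ B]
  [IsScalarTower ℂ B B] [SMulCommClass ℂ B B] [StarModule ℂ B]

/-- The completion of a pre-C*-algebra `B` as a normed space. The multiplication and the
involution below are the continuous extensions of those of `B`. -/
def CStarCompletion : Type _ := Completion B

namespace CStarCompletion

instance : NormedAddCommGroup (CStarCompletion B) :=
  inferInstanceAs (NormedAddCommGroup (Completion B))

instance : NormedSpace ℂ (CStarCompletion B) :=
  inferInstanceAs (NormedSpace ℂ (Completion B))

instance : ContinuousConstSMul ℂ (CStarCompletion B) :=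
  inferInstance

instance : CompleteSpace (CStarCompletion B) :=
  inferInstanceAs (CompleteSpace (Completion B))

variable {B}

/-- The canonical isometric embedding of `B` in its completion. -/
def of (b : B) : CStarCompletion B := (b : Completion B)

theorem isDenseInducing_of : IsDenseInducing (of : B → CStarCompletion B) :=
  Completion.isDenseInducing_coe

theorem continuous_of : Continuous (of : B → CStarCompletion B) := Completion.continuous_coe B

theorem norm_of (b : B) : ‖of b‖ = ‖b‖ := Completion.norm_coe b

theorem of_add (a b : B) : of (a + b) = of a + of b := Completion.coe_add a b

theorem of_zero : of (0 : B) = 0 := Completion.coe_zero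

theorem of_smul (c : ℂ) (b : B) : of (c • b) = c • of b := Completion.coe_smul c b

theorem induction_on {p : CStarCompletion B → Prop} (x : CStarCompletion B)
    (hp : IsClosed {x | p x}) (ih : ∀ b, p (of b)) : p x :=
  Completion.induction_on x hp ih

theorem induction_on₂ {p : CStarCompletion B → CStarCompletion B → Prop}
    (x y : CStarCompletion B)
    (hp : IsClosed {x : CStarCompletion B × CStarCompletion B | p x.1 x.2})
    (ih : ∀ a b, p (of a) (of b)) : p x y :=
  Completion.induction_on₂ x y hp ih

theorem induction_on₃ {p : CStarCompletion B → CStarCompletion B → CStarCompletion B → Prop}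
    (x y z : CStarCompletion B)
    (hp : IsClosed {x : CStarCompletion B × CStarCompletion B × CStarCompletion B |
      p x.1 x.2.1 x.2.2})
    (ih : ∀ a b c, p (of a) (of b) (of c)) : p x y z :=
  Completion.induction_on₃ x y z hp ih

instance : Mul (CStarCompletion B) :=
  ⟨Function.curry <| (isDenseInducing_of.prodMap isDenseInducing_of).extend
    (of ∘ Function.uncurry (fun a b : B => a * b))⟩

theorem of_mul (a b : B) : of (a * b) = of a * of b :=
  ((isDenseInducing_of.prodMap isDenseInducing_of).extend_eq
    (continuous_of.comp continuous_mul) (a, b)).symm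

instance : ContinuousMul (CStarCompletion B) where
  continuous_mul := by
    let m := (AddMonoidHom.mul : B →+ B →+ B).compr₂ (Completion.toCompl : B →+ Completion B)
    have hm : Continuous fun p : B × B => m p.1 p.2 :=
      (Completion.continuous_coe B).comp continuous_mul
    have di : IsDenseInducing (Completion.toCompl : B → Completion B) :=
      Completion.isDenseInducing_coe
    exact (di.extend_Z_bilin di hm :)

instance : NonUnitalNormedRing (CStarCompletion B) where
  __ := (inferInstance : NormedAddCommGroup (CStarCompletion B))
  __ := (inferInstance : Mul (CStarCompletion B))
  zero_mul a := by
    induction a using induction_on with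
    | hp => exact isClosed_eq (by fun_prop) continuous_const
    | ih a => rw [← of_zero, ← of_mul, zero_mul]
  mul_zero a := by
    induction a using induction_on with
    | hp => exact isClosed_eq (by fun_prop) continuous_const
    | ih a => rw [← of_zero, ← of_mul, mul_zero]
  mul_assoc a b c := by
    induction a, b, c using induction_on₃ with
    | hp => exact isClosed_eq (by fun_prop) (by fun_prop)
    | ih a b c => rw [← of_mul, ← of_mul, ← of_mul, ← of_mul, mul_assoc]
  left_distrib a b c := by
    induction a, b, c using induction_on₃ with
    | hp => exact isClosed_eq (by fun_prop) (by fun_prop)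
    | ih a b c => rw [← of_add, ← of_mul, ← of_mul, ← of_mul, ← of_add, mul_add]
  right_distrib a b c := by
    induction a, b, c using induction_on₃ with
    | hp => exact isClosed_eq (by fun_prop) (by fun_prop)
    | ih a b c => rw [← of_add, ← of_mul, ← of_mul, ← of_mul, ← of_add, add_mul]
  norm_mul_le a b := by
    induction a, b using induction_on₂ with
    | hp => exact isClosed_le (by fun_prop) (by fun_prop)
    | ih a b => rw [← of_mul, norm_of, norm_of, norm_of]; exact norm_mul_le a b

instance : Star (CStarCompletion B) :=
  ⟨Completion.map (star : B → B)⟩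

theorem of_star (b : B) : of (star b) = star (of b) :=
  (Completion.map_coe starNormedAddGroupHom.uniformContinuous b).symm

instance : ContinuousStar (CStarCompletion B) where
  continuous_star := (Completion.continuous_map : Continuous (Completion.map (star : B → B)))

instance : StarRing (CStarCompletion B) where
  star_involutive a := by
    induction a using induction_on with
    | hp => exact isClosed_eq (by fun_prop) continuous_id
    | ih a => rw [← of_star, ← of_star, star_star]
  star_mul a b := by
    induction a, b using induction_on₂ with
    | hp => exact isClosed_eq (by fun_prop) (by fun_prop)
    | ih a b => rw [← of_mul, ← of_star, ← of_star, ← of_star, ← of_mul, star_mul]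
  star_add a b := by
    induction a, b using induction_on₂ with
    | hp => exact isClosed_eq (by fun_prop) (by fun_prop)
    | ih a b => rw [← of_add, ← of_star, ← of_star, ← of_star, ← of_add, star_add]

instance : CStarRing (CStarCompletion B) where
  norm_mul_self_le a := by
    induction a using induction_on with
    | hp => exact isClosed_le (by fun_prop) (by fun_prop)
    | ih a => rw [← of_star, ← of_mul, norm_of, norm_of]; exact CStarRing.norm_mul_self_le a

instance : IsScalarTower ℂ (CStarCompletion B) (CStarCompletion B) where
  smul_assoc c a b := by
    induction a, b using induction_on₂ with
    | hp => exact isClosed_eq ((continuous_fst.const_smul c).mul continuous_snd)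
              ((continuous_fst.mul continuous_snd).const_smul c)
    | ih a b => simp only [smul_eq_mul, ← of_smul, ← of_mul, smul_mul_assoc]

instance : SMulCommClass ℂ (CStarCompletion B) (CStarCompletion B) where
  smul_comm c a b := by
    induction a, b using induction_on₂ with
    | hp => exact isClosed_eq ((continuous_fst.mul continuous_snd).const_smul c)
              (continuous_fst.mul (continuous_snd.const_smul c))
    | ih a b => simp only [smul_eq_mul, ← of_smul, ← of_mul, mul_smul_comm]

instance : StarModule ℂ (CStarCompletion B) where
  star_smul c a := by
    induction a using induction_on with
    | hp => exact isClosed_eq (continuous_id.const_smul c).star (continuous_star.fun_const_smul (star c))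
    | ih a => rw [← of_smul, ← of_star, ← of_star, ← of_smul, star_smul]

instance : NonUnitalCStarAlgebra (CStarCompletion B) where

end CStarCompletion

end Completion

/-! ### The enveloping C*-algebra -/

section Enveloping

variable (A : Type*) [NonUnitalCStarAlgebra A]

/-- The *-algebra `A`, with its norm forgotten and replaced by the seminorm `‖·‖_o`. -/
def WithGNSeminorm : Type _ := A

namespace WithGNSeminorm

instance : NonUnitalRing (WithGNSeminorm A) := inferInstanceAs (NonUnitalRing A)
instance : Module ℂ (WithGNSeminorm A) := inferInstanceAs (Module ℂ A)
instance : IsScalarTower ℂ (WithGNSeminorm A) (WithGNSeminorm A) :=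
  inferInstanceAs (IsScalarTower ℂ A A)
instance : SMulCommClass ℂ (WithGNSeminorm A) (WithGNSeminorm A) :=
  inferInstanceAs (SMulCommClass ℂ A A)
instance : StarRing (WithGNSeminorm A) := inferInstanceAs (StarRing A)
instance : StarModule ℂ (WithGNSeminorm A) := inferInstanceAs (StarModule ℂ A)

instance : SeminormedAddCommGroup (WithGNSeminorm A) :=
  AddGroupSeminorm.toSeminormedAddCommGroup (E := WithGNSeminorm A)
    { toFun := fun a => gnSeminorm (A := A) a
      map_zero' := gnSeminorm_zero (A := A)
      add_le' := gnSeminorm_add_le (A := A)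
      neg' := gnSeminorm_neg (A := A) }

theorem norm_def (a : WithGNSeminorm A) : ‖a‖ = gnSeminorm (A := A) a := rfl

instance : NonUnitalSeminormedRing (WithGNSeminorm A) where
  __ := (inferInstance : SeminormedAddCommGroup (WithGNSeminorm A))
  __ := (inferInstance : NonUnitalRing (WithGNSeminorm A))
  norm_mul_le := gnSeminorm_mul_le (A := A)

instance : NormedSpace ℂ (WithGNSeminorm A) where
  norm_smul_le := gnSeminorm_smul_le (A := A)

instance : NormedStarGroup (WithGNSeminorm A) where
  norm_star_le a := (gnSeminorm_star (A := A) a).le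

end WithGNSeminorm

/-- The quotient of `A` by the *-radical `{a | ‖a‖_o = 0}`, normed by
`‖a + rad‖ = ‖a‖_o`. -/
abbrev RadicalQuotient : Type _ := SeparationQuotient (WithGNSeminorm A)

namespace RadicalQuotient

variable {A} in
/-- The quotient map from `A`. -/
def mk (a : A) : RadicalQuotient A := SeparationQuotient.mk (X := WithGNSeminorm A) a

variable {A} in
theorem norm_mk (a : A) : ‖mk a‖ = gnSeminorm a := rfl

variable {A} in
theorem mk_eq_mk_iff (a b : A) : mk a = mk b ↔ gnSeminorm (a - b) = 0 := by
  rw [← sub_eq_zero, ← norm_eq_zero]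
  exact Iff.rfl

instance : Star (RadicalQuotient A) where
  star := Quotient.map' star fun _ _ h => h.map continuous_star

theorem mk_star (a : A) : mk (star a) = star (mk a) := rfl

instance : StarRing (RadicalQuotient A) where
  star_involutive := SeparationQuotient.surjective_mk.forall.mpr fun a =>
    congrArg SeparationQuotient.mk (star_star a)
  star_mul := SeparationQuotient.surjective_mk.forall₂.mpr fun a b =>
    congrArg SeparationQuotient.mk (star_mul a b)
  star_add := SeparationQuotient.surjective_mk.forall₂.mpr fun a b =>
    congrArg SeparationQuotient.mk (star_add a b)

instance : StarModule ℂ (RadicalQuotient A) where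
  star_smul c := SeparationQuotient.surjective_mk.forall.mpr fun a =>
    congrArg SeparationQuotient.mk (star_smul c a)

instance : IsScalarTower ℂ (RadicalQuotient A) (RadicalQuotient A) where
  smul_assoc c := SeparationQuotient.surjective_mk.forall₂.mpr fun a b =>
    congrArg SeparationQuotient.mk (smul_mul_assoc c a b)

instance : SMulCommClass ℂ (RadicalQuotient A) (RadicalQuotient A) where
  smul_comm c := SeparationQuotient.surjective_mk.forall₂.mpr fun a b =>
    congrArg SeparationQuotient.mk (mul_smul_comm c a b).symm

instance : CStarRing (RadicalQuotient A) where
  norm_mul_self_le := SeparationQuotient.surjective_mk.forall.mpr fun a =>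
    gnSeminorm_mul_self_le (A := A) a

end RadicalQuotient

/-- The enveloping C*-algebra `C*(A)`: the completion of the quotient of `A` by its
*-radical, in the norm induced by `‖·‖_o`. -/
abbrev EnvelopingCStarAlgebra : Type _ := CStarCompletion (RadicalQuotient A)

/-- The canonical *-homomorphism `j : A → C*(A)`, `a ↦ a + rad`. -/
def toEnveloping : A →⋆ₙₐ[ℂ] EnvelopingCStarAlgebra A where
  toFun a := CStarCompletion.of (RadicalQuotient.mk a)
  map_smul' c a := CStarCompletion.of_smul c (RadicalQuotient.mk a)
  map_zero' := CStarCompletion.of_zero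
  map_add' a b := CStarCompletion.of_add (RadicalQuotient.mk a) (RadicalQuotient.mk b)
  map_mul' a b := CStarCompletion.of_mul (RadicalQuotient.mk a) (RadicalQuotient.mk b)
  map_star' a := CStarCompletion.of_star (RadicalQuotient.mk a)

end Enveloping

end GelfandNaimark

end

/-!
For `h ≥ 0` in a unital C*-algebra, `‖1 + h‖ = 1 + ‖h‖`, so a Hahn–Banach functional `f` of norm at
most one that norms `1 + h` satisfies both `f 1 = 1` and `f h = ‖h‖`. A functional of norm at most
one taking the value `1` at the unit is positive. Applying this to `h = a* a` in the unitization
of `A` and restricting to `A` gives a state `ψ` with `ψ(a* a) = ‖a‖²`, whence `‖a‖_o = ‖a‖`.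

If `π_u(a) = 0`, then evaluating `π_ψ(a)` at the vector `a*` shows that `ψ((a a*)* (a a*)) = 0` for
every state `ψ`, so `a a* = 0` and `a = 0`. Thus `π_u` is an injective *-homomorphism between
C*-algebras, hence isometric. The map `j` is isometric with dense range on a complete space, hence
onto.
-/

namespace GelfandNaimark

open scoped ComplexOrder

section HahnBanach

variable (𝕜 : Type*) {E : Type*} [RCLike 𝕜] [SeminormedAddCommGroup E] [NormedSpace 𝕜 E]

theorem exists_dual_vector_of_norm_add_eq {x y : E} (h : ‖x + y‖ = ‖x‖ + ‖y‖) :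
    ∃ g : StrongDual 𝕜 E, ‖g‖ ≤ 1 ∧ g x = ‖x‖ ∧ g y = ‖y‖ := by
  obtain ⟨g, hg, hgxy⟩ := exists_dual_vector'' 𝕜 (x + y)
  have hx : ‖g x‖ ≤ ‖x‖ := by simpa only [one_mul] using g.le_of_opNorm_le hg x
  have hy : ‖g y‖ ≤ ‖y‖ := by simpa only [one_mul] using g.le_of_opNorm_le hg y
  have hsum : RCLike.re (g x) + RCLike.re (g y) = ‖x‖ + ‖y‖ := by
    rw [← map_add, ← map_add, hgxy, RCLike.ofReal_re, h]
  have eq_ofReal {z : 𝕜} {r : ℝ} (hre : RCLike.re z = r) (hz : ‖z‖ ≤ r) : z = r := by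
    subst hre
    exact (RCLike.re_eq_self_of_le hz).symm
  have hx' := RCLike.re_le_norm (g x)
  have hy' := RCLike.re_le_norm (g y)
  exact ⟨g, hg, eq_ofReal (by linarith) hx, eq_ofReal (by linarith) hy⟩

end HahnBanach

section Isometry

variable {α β : Type*} [EMetricSpace α] [CompleteSpace α] [EMetricSpace β]

theorem surjective_of_isometry_of_denseRange {f : α → β} (hf : Isometry f) (hd : DenseRange f) :
    Function.Surjective f := by
  rw [← Set.range_eq_univ, ← hf.isClosedEmbedding.isClosed_range.closure_eq, hd.closure_range]

end Isometry

section UnitalFunctionals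

variable {B : Type*} [CStarAlgebra B] {f : StrongDual ℂ B}

theorem norm_add_ofReal_mul_I_smul_one_sq_le {b : B} (hb : IsSelfAdjoint b) (t : ℝ) :
    ‖b + (t * Complex.I) • (1 : B)‖ ^ 2 ≤ ‖b‖ ^ 2 + t ^ 2 := by
  nontriviality B using norm_of_subsingleton, sq_nonneg
  set z : ℂ := t * Complex.I
  have hz : z * z = -((t ^ 2 : ℝ) : ℂ) := by
    push_cast
    linear_combination (t : ℂ) ^ 2 * Complex.I_sq
  have hstar : star (b + z • (1 : B)) = b - z • 1 := by
    rw [star_add, star_smul, star_one, hb.star_eq, RCLike.star_def, map_mul, Complex.conj_ofReal,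
      Complex.conj_I, mul_neg, neg_smul, sub_eq_add_neg]
  have hsq : star (b + z • (1 : B)) * (b + z • (1 : B)) = b * b + ((t ^ 2 : ℝ) : ℂ) • (1 : B) := by
    rw [hstar, ← ((Commute.one_right b).smul_right z).mul_self_sub_mul_self_eq',
      smul_mul_smul_comm, one_mul, hz, neg_smul, sub_neg_eq_add]
  calc ‖b + z • (1 : B)‖ ^ 2 = ‖b * b + ((t ^ 2 : ℝ) : ℂ) • (1 : B)‖ := by
        rw [← hsq, CStarRing.norm_star_mul_self, sq]
    _ ≤ ‖b * b‖ + ‖((t ^ 2 : ℝ) : ℂ) • (1 : B)‖ := norm_add_le _ _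
    _ = ‖b‖ ^ 2 + t ^ 2 := by
        rw [hb.norm_mul_self, norm_smul, Complex.norm_of_nonneg (sq_nonneg t), norm_one, mul_one]

theorem im_apply_eq_zero_of_isSelfAdjoint (hf : ‖f‖ ≤ 1) (hf1 : f 1 = 1) {b : B}
    (hb : IsSelfAdjoint b) : (f b).im = 0 := by
  have hbound (t : ℝ) : ((f b).im + t) ^ 2 ≤ ‖b‖ ^ 2 + t ^ 2 := by
    calc ((f b).im + t) ^ 2 = (f (b + (t * Complex.I) • (1 : B))).im ^ 2 := by simp [hf1]
      _ ≤ ‖f (b + (t * Complex.I) • (1 : B))‖ ^ 2 :=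
          sq_le_sq.mpr ((Complex.abs_im_le_norm _).trans (le_abs_self _))
      _ ≤ (1 * ‖b + (t * Complex.I) • (1 : B)‖) ^ 2 := by gcongr; exact f.le_of_opNorm_le hf _
      _ ≤ ‖b‖ ^ 2 + t ^ 2 := by
          rw [one_mul]
          exact norm_add_ofReal_mul_I_smul_one_sq_le hb t
  by_contra him
  -- This `t` makes the cross term `2 t Im f(b)` equal to `2 ‖b‖²`, more than the bound allows.
  have hb' := hbound (‖b‖ ^ 2 / (f b).im)
  have hcancel : (f b).im * (‖b‖ ^ 2 / (f b).im) = ‖b‖ ^ 2 := mul_div_cancel₀ _ him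
  have hpos : 0 < (f b).im ^ 2 := by positivity
  nlinarith [sq_nonneg ‖b‖]

variable [PartialOrder B] [StarOrderedRing B]

theorem re_apply_nonneg_of_nonneg (hf : ‖f‖ ≤ 1) (hf1 : f 1 = 1) {b : B} (hb : 0 ≤ b) :
    0 ≤ (f b).re := by
  have hnorm : ‖algebraMap ℝ B ‖b‖ - b‖ ≤ ‖b‖ := by
    refine (CStarAlgebra.norm_le_iff_le_algebraMap _ (norm_nonneg b) ?_).mpr (sub_le_self _ hb)
    exact sub_nonneg.mpr (IsSelfAdjoint.le_algebraMap_norm_self (.of_nonneg hb))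
  have hdist : ‖(‖b‖ : ℂ) - f b‖ ≤ ‖b‖ :=
    calc ‖(‖b‖ : ℂ) - f b‖ = ‖f (algebraMap ℝ B ‖b‖ - b)‖ := by
          rw [map_sub, Algebra.algebraMap_eq_smul_one, ← Complex.coe_smul, map_smul, hf1,
            smul_eq_mul, mul_one]
      _ ≤ 1 * ‖algebraMap ℝ B ‖b‖ - b‖ := f.le_of_opNorm_le hf _
      _ ≤ ‖b‖ := by rwa [one_mul]
  simpa using (Complex.re_le_norm _).trans hdist

theorem apply_nonneg_of_nonneg (hf : ‖f‖ ≤ 1) (hf1 : f 1 = 1) {b : B} (hb : 0 ≤ b) : 0 ≤ f b :=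
  Complex.nonneg_iff.mpr ⟨re_apply_nonneg_of_nonneg hf hf1 hb,
    (im_apply_eq_zero_of_isSelfAdjoint hf hf1 (.of_nonneg hb)).symm⟩

theorem norm_one_add_of_nonneg [Nontrivial B] {h : B} (hh : 0 ≤ h) : ‖1 + h‖ = ‖(1 : B)‖ + ‖h‖ := by
  refine le_antisymm (norm_add_le _ _) ?_
  have hmem : 1 + ‖h‖ ∈ spectrum ℝ (1 + h) := by
    simpa only [map_one, add_comm] using (spectrum.add_mem_add_iff (R := ℝ) (s := 1)).mpr
      (CStarAlgebra.norm_mem_spectrum_of_nonneg hh)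
  rw [norm_one]
  exact (le_abs_self _).trans (spectrum.norm_le_norm_of_mem hmem)

theorem exists_positive_map_one_apply_eq_norm [Nontrivial B] {h : B} (hh : 0 ≤ h) :
    ∃ f : B →ₚ[ℂ] ℂ, f 1 = 1 ∧ f h = ‖h‖ := by
  obtain ⟨g, hg, hg1, hgh⟩ := exists_dual_vector_of_norm_add_eq ℂ (norm_one_add_of_nonneg hh)
  rw [norm_one, RCLike.ofReal_one] at hg1
  exact ⟨.mk₀ (g : B →ₗ[ℂ] ℂ) fun _ => apply_nonneg_of_nonneg hg hg1, hg1, hgh⟩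

end UnitalFunctionals

section States

theorem variation_eq_one_of_re_apply_star_mul_self_le {A : Type*} [NonUnitalNormedRing A]
    [NormedSpace ℂ A] [StarRing A] {φ : A →ₗ[ℂ] ℂ} (h : 1 ∈ variationBounds φ) {c : A}
    (hc : φ c ≠ 0) (hle : (φ (star c * c)).re ≤ ‖φ c‖ ^ 2) : variation φ = 1 := by
  refine IsLeast.csInf_eq ⟨h, fun v ⟨hv, hbound⟩ => ?_⟩
  have hpos : 0 < ‖φ c‖ ^ 2 := by positivity
  refine le_of_mul_le_mul_right ?_ hpos
  calc 1 * ‖φ c‖ ^ 2 = ‖φ c‖ ^ 2 := one_mul _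
    _ ≤ v * (φ (star c * c)).re := hbound c
    _ ≤ v * ‖φ c‖ ^ 2 := mul_le_mul_of_nonneg_left hle hv

theorem norm_apply_star_mul_sq_le {A : Type*} [NonUnitalCStarAlgebra A] [PartialOrder A]
    [StarOrderedRing A] (f : A →ₚ[ℂ] ℂ) (a b : A) :
    ‖f (star a * b)‖ ^ 2 ≤ (f (star a * a)).re * (f (star b * b)).re := by
  have hnonneg (x : A) : 0 ≤ (f (star x * x)).re :=
    (Complex.nonneg_iff.mp (f.map_nonneg (star_mul_self_nonneg x))).1
  rw [← Real.le_sqrt (norm_nonneg _) (mul_nonneg (hnonneg a) (hnonneg b)),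
    Real.sqrt_mul (hnonneg a)]
  exact norm_inner_le_norm (𝕜 := ℂ) (f.toPreGNS a) (f.toPreGNS b)

variable {A : Type*} [NonUnitalCStarAlgebra A]

theorem isState_comp {B : Type*} [CStarAlgebra B] [PartialOrder B] [StarOrderedRing B]
    {f : B →ₚ[ℂ] ℂ} (hf : f 1 = 1) (ι : A →⋆ₙₐ[ℂ] B) {c : A} (hc : c ≠ 0)
    (hfc : ‖f (ι c)‖ = ‖c‖) : IsState ((f : B →ₗ[ℂ] ℂ) ∘ₗ (ι : A →ₗ[ℂ] B)) := by
  set φ : A →ₗ[ℂ] ℂ := (f : B →ₗ[ℂ] ℂ) ∘ₗ (ι : A →ₗ[ℂ] B)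
  have hstar (a : A) : φ (star a * a) = f (star (ι a) * ι a) := by
    simp [φ, map_star]
  have hcont : Continuous φ :=
    (map_continuous f).comp (AddMonoidHomClass.continuous_of_bound ι 1 fun a => by
      simpa only [one_mul] using NonUnitalStarAlgHom.norm_apply_le ι a)
  have hbound : 1 ∈ variationBounds φ := ⟨zero_le_one, fun a => by
    rw [hstar, show φ a = f (ι a) from rfl]
    simpa only [star_one, one_mul, hf, Complex.one_re] using norm_apply_star_mul_sq_le f 1 (ι a)⟩
  have hφc : (φ (star c * c)).re ≤ ‖φ c‖ ^ 2 :=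
    calc (φ (star c * c)).re ≤ ‖f (star (ι c) * ι c)‖ := hstar c ▸ Complex.re_le_norm _
      _ ≤ ‖f 1‖ * ‖star (ι c) * ι c‖ := f.norm_apply_le_of_nonneg _ (star_mul_self_nonneg _)
      _ = ‖ι c‖ ^ 2 := by rw [hf, norm_one, one_mul, CStarRing.norm_star_mul_self, sq]
      _ ≤ ‖c‖ ^ 2 := by gcongr; exact NonUnitalStarAlgHom.norm_apply_le ι c
      _ = ‖φ c‖ ^ 2 := congrArg (· ^ 2) hfc.symm
  refine ⟨fun a => hstar a ▸ f.map_nonneg (star_mul_self_nonneg _),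
    fun b => Continuous.continuousOn (by fun_prop), ⟨1, hbound⟩,
    variation_eq_one_of_re_apply_star_mul_self_le hbound ?_ hφc⟩
  exact norm_ne_zero_iff.mp (hfc.trans_ne (norm_ne_zero_iff.mpr hc))

theorem exists_state_apply_star_mul_self_eq_norm_sq {a : A} (ha : a ≠ 0) :
    ∃ ψ : State A, ψ.1 (star a * a) = (‖a‖ ^ 2 : ℝ) := by
  let _ : PartialOrder (Unitization ℂ A) := CStarAlgebra.spectralOrder _
  have _ : StarOrderedRing (Unitization ℂ A) := CStarAlgebra.spectralOrderedRing _
  let ι := Unitization.inrNonUnitalStarAlgHom ℂ A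
  obtain ⟨f, hf, hfa⟩ := exists_positive_map_one_apply_eq_norm (star_mul_self_nonneg (ι a))
  have hι : ‖ι (star a * a)‖ = ‖star a * a‖ := Unitization.norm_inr (𝕜 := ℂ) _
  rw [← map_star, ← map_mul, hι] at hfa
  refine ⟨⟨_, isState_comp hf ι ((CStarRing.star_mul_self_ne_zero_iff a).mpr ha) ?_⟩, ?_⟩
  · rw [hfa, Complex.norm_real, norm_norm]
  · exact hfa.trans (by rw [CStarRing.norm_star_mul_self, sq])

theorem gnSeminorm_eq_norm (a : A) : gnSeminorm a = ‖a‖ := by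
  refine le_antisymm (Real.iSup_le (fun ψ => ψ.sqrt_le_norm a) (norm_nonneg a)) ?_
  rcases eq_or_ne a 0 with rfl | ha
  · exact norm_zero.trans_le (gnSeminorm_nonneg 0)
  · obtain ⟨ψ, hψ⟩ := exists_state_apply_star_mul_self_eq_norm_sq ha
    calc ‖a‖ = √(ψ.1 (star a * a)).re := by
          rw [hψ, Complex.ofReal_re, Real.sqrt_sq (norm_nonneg a)]
      _ ≤ gnSeminorm a := ψ.sqrt_le_gnSeminorm a

end States

section UniversalRepresentation

variable {A : Type*} [NonUnitalCStarAlgebra A]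

attribute [local instance] CStarAlgebra.spectralOrder CStarAlgebra.spectralOrderedRing in
theorem State.norm_gnsRep_toPreGNS (ψ : State A) (a b : A) :
    ‖ψ.gnsRep a (ψ.toPositive.toPreGNS b : ψ.GNSSpace)‖ = √(ψ.1 (star (a * b) * (a * b))).re := by
  rw [State.gnsRep, PositiveLinearMap.gnsNonUnitalStarAlgHom_apply_coe,
    UniformSpace.Completion.norm_coe]
  exact ψ.gns_norm (a * b)

theorem gnsRep_eq_zero_of_universalRep_eq_zero {a : A} (ha : universalRep A a = 0)
    (ψ : State A) : ψ.gnsRep a = 0 := by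
  classical
  ext x
  have hx := universalRep_apply a (lp.single 2 ψ x) ψ
  rw [ha, lp.single_apply_self] at hx
  exact hx.symm

theorem universalRep_injective : Function.Injective (universalRep A) := by
  refine (injective_iff_map_eq_zero _).mpr fun a ha => ?_
  have hstate (ψ : State A) : √(ψ.1 (star (a * star a) * (a * star a))).re = 0 := by
    rw [← ψ.norm_gnsRep_toPreGNS, gnsRep_eq_zero_of_universalRep_eq_zero ha,
      zero_apply, norm_zero]
  have hnorm : ‖a * star a‖ = 0 := by
    rw [← gnSeminorm_eq_norm, gnSeminorm, funext hstate, Real.iSup_const_zero]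
  exact (CStarRing.mul_star_self_eq_zero_iff a).mp (norm_eq_zero.mp hnorm)

theorem norm_universalRep (a : A) : ‖universalRep A a‖ = ‖a‖ :=
  NonUnitalStarAlgHom.norm_map (universalRep A) universalRep_injective a

end UniversalRepresentation

section EnvelopingAlgebra

variable {A : Type*} [NonUnitalCStarAlgebra A]

theorem norm_toEnveloping (a : A) : ‖toEnveloping A a‖ = ‖a‖ :=
  calc ‖toEnveloping A a‖ = ‖RadicalQuotient.mk a‖ := CStarCompletion.norm_of _
    _ = gnSeminorm a := RadicalQuotient.norm_mk a
    _ = ‖a‖ := gnSeminorm_eq_norm a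

theorem denseRange_toEnveloping : DenseRange (toEnveloping A) :=
  CStarCompletion.isDenseInducing_of.dense.comp
    (SeparationQuotient.surjective_mk (X := WithGNSeminorm A)).denseRange
    CStarCompletion.continuous_of

end EnvelopingAlgebra

end GelfandNaimark

theorem mainTheorem2 {A : Type*} [NonUnitalCStarAlgebra A] :
    -- the universal representation is isometric, and its norm is the Gelfand-Naimark seminorm
    (∀ a : A, ‖GelfandNaimark.universalRep A a‖ = GelfandNaimark.gnSeminorm a ∧
      GelfandNaimark.gnSeminorm a = ‖a‖) ∧
    -- it is an isomorphism of C*-algebras from `A` onto a C*-algebra of bounded operators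
    (IsClosed (NonUnitalStarAlgHom.range (GelfandNaimark.universalRep A) :
        Set (GelfandNaimark.UniversalSpace A →L[ℂ] GelfandNaimark.UniversalSpace A)) ∧
      ∃ e : A ≃⋆ₐ[ℂ] NonUnitalStarAlgHom.range (GelfandNaimark.universalRep A),
        Isometry e ∧ ∀ a : A,
          (e a : GelfandNaimark.UniversalSpace A →L[ℂ] GelfandNaimark.UniversalSpace A) =
            GelfandNaimark.universalRep A a) ∧
    -- the canonical map `A → C*(A)` is an isomorphism of C*-algebras
    (∃ e : A ≃⋆ₐ[ℂ] GelfandNaimark.EnvelopingCStarAlgebra A,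
      Isometry e ∧ ∀ a : A, e a = GelfandNaimark.toEnveloping A a) := by
  have hu : Isometry (GelfandNaimark.universalRep A) :=
    AddMonoidHomClass.isometry_of_norm _ GelfandNaimark.norm_universalRep
  have hj : Isometry (GelfandNaimark.toEnveloping A) :=
    AddMonoidHomClass.isometry_of_norm _ GelfandNaimark.norm_toEnveloping
  have hj_surj : Function.Surjective (GelfandNaimark.toEnveloping A) :=
    GelfandNaimark.surjective_of_isometry_of_denseRange hj GelfandNaimark.denseRange_toEnveloping
  refine ⟨fun a => ⟨?_, GelfandNaimark.gnSeminorm_eq_norm a⟩, ⟨?_, ?_⟩, ?_⟩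
  · rw [GelfandNaimark.norm_universalRep, GelfandNaimark.gnSeminorm_eq_norm]
  · rw [NonUnitalStarAlgHom.coe_range]
    exact hu.isClosedEmbedding.isClosed_range
  · exact ⟨.ofInjective' (GelfandNaimark.universalRep A) hu.injective, hu, fun _ => rfl⟩
  · exact ⟨.ofBijective (GelfandNaimark.toEnveloping A) ⟨hj.injective, hj_surj⟩, hj, fun _ => rfl⟩
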